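/- Let $(R,\mathfrak m)$ be a commutative Noetherian local ring with $\dim R=n$, and let $\mathfrak a$ be an ideal of $R$. For $R$-modules $M,N$ and $i\ge 0$ put $$H^i_{\mathfrak a}(N)=\varinjlim_{k}\operatorname{Ext}^i_R(R/\mathfrak a^k,N),\qquad H^i_{\mathfrak a}(M,N)=\varinjlim_{k}\operatorname{Ext}^i_R(M/\mathfrak a^kM,N).$$ Let $M$ be a finitely generated $R$-module, and let $N$ be an $R$-module (not necessarily finitely generated) such that $H^i_{\mathfrak a}(N)=0$ for all integers $i\ge 0$ with $i\neq n-1$ and $i\neq n$. Then the set $\operatorname{Ass}_R\bigl(H^t_{\mathfrak a}(M,N)\bigr)$ of associated primes is finite for every integer $t\ge 0$. -/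

import Mathlib

open CategoryTheory CategoryTheory.Limits Opposite

universe u

noncomputable section

namespace GeneralizedLocalCohomology

variable {R : Type u} [CommRing R]

/-- The inverse system `M / a ^ k M` (`k : ℕ`) of `R`-modules, with the canonical projections
`M / a ^ l M ⟶ M / a ^ k M` for `k ≤ l`. -/
def quotientPowers (a : Ideal R) (M : ModuleCat.{u} R) : ℕᵒᵖ ⥤ ModuleCat.{u} R where
  obj k := ModuleCat.of R (M ⧸ (a ^ unop k • (⊤ : Submodule R M)))
  map {l k} f := ModuleCat.ofHom <|
    Submodule.mapQ (a ^ unop l • (⊤ : Submodule R M)) (a ^ unop k • (⊤ : Submodule R M))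
      LinearMap.id (Submodule.smul_mono_left (Ideal.pow_le_pow_right f.unop.le))
  map_id k := by
    ext x
    rfl
  map_comp f g := by
    ext x
    rfl

/-- The direct system of functors `Ext^i(M / a ^ k M, -)`, `k : ℕ`. -/
def extDiagram (a : Ideal R) (i : ℕ) (M : ModuleCat.{u} R) :
    (ℕᵒᵖ)ᵒᵖ ⥤ ModuleCat.{u} R ⥤ ModuleCat.{u} R :=
  (quotientPowers a M).op ⋙ Ext R (ModuleCat.{u} R) i

end GeneralizedLocalCohomology

/-- The `i`-th generalized local cohomology functor `H^i_a(M, -)` of the module `M` with respect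
to the ideal `a`: the direct limit over `k` of the functors `Ext^i(M / a ^ k M, -)`. -/
def generalizedLocalCohomology {R : Type u} [CommRing R] (a : Ideal R) (i : ℕ)
    (M : ModuleCat.{u} R) : ModuleCat.{u} R ⥤ ModuleCat.{u} R :=
  colimit (GeneralizedLocalCohomology.extDiagram a i M)

end

noncomputable section

/-! Put d(p) = dim R/p. If p is not maximal, then d(p) ≥ 1, and Grothendieck vanishing at p gives
H^n_a(L)_p = 0 for every module L (`vanishesAt_of_support`, extended from finitely generated modules
by `VanishesAt.of_forall_finite`). So H^{n-1}_a(-)_p is right exact and vanishes identically once it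
vanishes on R (`VanishesAt.of_vanishesAt_self`), which holds for all but finitely many nonmaximal p
(`finite_setOf_not_vanishesAt`). With the hypothesis on N, every H^i_a(N)_p is zero outside a finite
set of primes. Dévissage then gives Ext^i(X, N)_p = 0 for finitely generated X killed by a power of
a (`exists_smul_ext_eq_zero`), hence H^t_a(M, N)_p = 0, and no such p is associated.

Neither localizations nor colimits are formed in the argument: `VanishesAt` asks that each class on
R/a^k, restricted to some R/a^l, be killed by an element outside p. Long exact sequences are taken
in `Abelian.Ext`, which is first identified with the resolution-based `Ext` of the statement. -/

lemma HomologicalComplex.homologyπ_eq_zero_iff {A : Type*} [Ring A] {ι : Type*}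
    {c : ComplexShape ι} (K : HomologicalComplex (ModuleCat A) c) (m n : ι) (hm : c.prev n = m)
    (z : K.cycles n) :
    (K.homologyπ n).hom z = 0 ↔ ∃ x, (K.d m n).hom x = (K.iCycles n).hom z := by
  have inj : Function.Injective (K.iCycles n).hom :=
    (ModuleCat.mono_iff_injective _).mp inferInstance
  have ex : (ShortComplex.mk (K.toCycles m n) (K.homologyπ n) (by simp)).Exact :=
    ShortComplex.exact_of_g_is_cokernel _ (K.homologyIsCokernel m n hm)
  rw [ShortComplex.moduleCat_exact_iff_ker_sub_range] at ex
  constructor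
  · intro h
    obtain ⟨x, hx⟩ := ex h
    refine ⟨x, ?_⟩
    rw [← K.toCycles_i m n]
    exact congrArg (K.iCycles n).hom hx
  · rintro ⟨x, hx⟩
    have : (K.toCycles m n).hom x = z := by
      apply inj
      rw [← hx, ← K.toCycles_i m n]
      rfl
    rw [← this]
    exact ConcreteCategory.congr_hom (K.toCycles_comp_homologyπ m n) x

/-! ### The two definitions of Ext agree, naturally in the first variable. -/

namespace CategoryTheory.ProjectiveResolution

universe w v u' t

variable {R : Type t} [CommRing R] {C : Type u'} [Category.{v} C] [Abelian C] [Linear R C]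

/-- The morphism `P_n ⟶ Y` underlying a cocycle of the complex `Hom(P, Y)`. -/
def cocycleHom {X Y : C} (P : ProjectiveResolution X) {n : ℕ}
    (z : (P.complex.linearYonedaObj R Y).cycles n) : P.complex.X n ⟶ Y :=
  ((P.complex.linearYonedaObj R Y).iCycles n).hom z

lemma d_comp_cocycleHom {X Y : C} (P : ProjectiveResolution X) {n : ℕ}
    (z : (P.complex.linearYonedaObj R Y).cycles n) :
    P.complex.d (n + 1) n ≫ P.cocycleHom z = 0 :=
  ConcreteCategory.congr_hom ((P.complex.linearYonedaObj R Y).iCycles_d n (n + 1)) z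

variable (R) in
lemma exists_cocycleHom_eq {X Y : C} (P : ProjectiveResolution X) {n : ℕ}
    (f : P.complex.X n ⟶ Y) (hf : P.complex.d (n + 1) n ≫ f = 0) :
    ∃ z : (P.complex.linearYonedaObj R Y).cycles n, P.cocycleHom z = f := by
  have hf' : ((forget₂ (ModuleCat.{v} R) Ab).map
      ((P.complex.linearYonedaObj R Y).d n (n + 1))).hom f = 0 := hf
  exact ⟨(P.complex.linearYonedaObj R Y).cyclesMk f (n + 1) (by simp) hf',
    (P.complex.linearYonedaObj R Y).i_cyclesMk f (n + 1) (by simp) hf'⟩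

variable (R) in
/-- The map of complexes `Hom(P, Y) ⟶ Hom(P', Y)` induced by `P' ⟶ P`. -/
def linearYonedaMap {X X' : C} {P : ProjectiveResolution X} {P' : ProjectiveResolution X'}
    (φ : P'.complex ⟶ P.complex) (Y : C) :
    P.complex.linearYonedaObj R Y ⟶ P'.complex.linearYonedaObj R Y :=
  (HomologicalComplex.unopFunctor _ _).map
    ((((linearYoneda R C).obj Y).rightOp.mapHomologicalComplex _).map φ).op

lemma _root_.CategoryTheory.Iso.inv_comp_eq_comp_inv {D : Type*} [Category* D] {A B A' B' : D}
    {f : A ⟶ B} {g : A' ⟶ B'} {a : A ≅ A'} {b : B ≅ B'} (h : f ≫ b.hom = a.hom ≫ g) :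
    a.inv ≫ f = g ≫ b.inv := by
  rw [Iso.inv_comp_eq, ← Category.assoc, ← h, Category.assoc, Iso.hom_inv_id, Category.comp_id]

lemma isoExt_hom_naturality [EnoughProjectives C] {X X' : C} {P : ProjectiveResolution X}
    {P' : ProjectiveResolution X'} {g : X' ⟶ X} (φ : Hom P' P g) (Y : C) (n : ℕ) :
    ((Ext R C n).map g.op).app Y ≫ (P'.isoExt n Y).hom =
      (P.isoExt n Y).hom ≫ HomologicalComplex.homologyMap (linearYonedaMap R φ.hom Y) n := by
  -- `isoExt` is assembled from a left derived functor with values in the opposite category and the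
  -- commutation of homology with `op`. The two naturality squares are transposed and pasted.
  have h₁ := isoLeftDerivedObj_inv_naturality g P' P φ.hom
    (by simpa using φ.hom_f_zero_comp_π_f_zero) ((linearYoneda R C).obj Y).rightOp n
  have h₂ := HomologicalComplex.homologyOp_hom_naturality (linearYonedaMap R φ.hom Y) n
  have h₃ := Iso.inv_comp_eq_comp_inv h₂
  have h₁' := congrArg Quiver.Hom.unop h₁
  have h₃' := congrArg Quiver.Hom.unop h₃
  exact ((CommSq.mk h₁').vert_comp (CommSq.mk h₃')).w

variable [HasExt.{w} C]

lemma smul_extMk {X Y : C} (P : ProjectiveResolution X) {n : ℕ} (r : R)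
    (f : P.complex.X n ⟶ Y) (m : ℕ) (hm : n + 1 = m) (hf : P.complex.d m n ≫ f = 0) :
    P.extMk (r • f) m hm (by simp [hf]) = r • P.extMk f m hm hf := by
  rw [Abelian.Ext.smul_eq_comp_mk₀, extMk_comp_mk₀]
  congr 1
  simp

lemma extMk_zero_degree_eq_zero_iff {X Y : C} (P : ProjectiveResolution X)
    (f : P.complex.X 0 ⟶ Y) (m : ℕ) (hm : 0 + 1 = m) (hf : P.complex.d m 0 ≫ f = 0) :
    P.extMk f m hm hf = 0 ↔ f = 0 := by
  constructor
  · intro h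
    rw [← P.extEquivCohomologyClass.apply_eq_iff_eq, extEquivCohomologyClass_extMk,
      extEquivCohomologyClass_zero, CochainComplex.HomComplex.CohomologyClass.mk_eq_zero_iff,
      CochainComplex.HomComplex.Cocycle.toSingleMk_mem_coboundaries_iff _ _ _ _ _ 1 (by simp)] at h
    obtain ⟨g, hg⟩ := h
    -- A coboundary in degree 0 factors through cochain degree 1, where the resolution is zero.
    have h0 : g = 0 := (P.cochainComplex.isZero_of_isStrictlyLE 0 1 (by lia)).eq_of_src _ _
    rw [h0, comp_zero] at hg
    rw [← cancel_epi (P.cochainComplexXIso (-((0 : ℕ) : ℤ)) 0 rfl).hom, ← hg, comp_zero]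
  · rintro rfl
    simp

variable (R) in
/-- The class in `Ext` of a cocycle of the complex computing `Ext` by a projective resolution. -/
def cyclesToExt {X : C} (P : ProjectiveResolution X) (Y : C) (n : ℕ) :
    (P.complex.linearYonedaObj R Y).cycles n →ₗ[R] Abelian.Ext X Y n where
  toFun z := P.extMk (P.cocycleHom z) (n + 1) rfl (P.d_comp_cocycleHom z)
  map_add' x y := by
    rw [add_extMk]
    congr 1
    exact map_add ((P.complex.linearYonedaObj R Y).iCycles n).hom x y
  map_smul' r x := by
    rw [RingHom.id_apply, ← smul_extMk]
    congr 1
    exact map_smul ((P.complex.linearYonedaObj R Y).iCycles n).hom r x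

lemma cyclesToExt_apply {X Y : C} (P : ProjectiveResolution X) {n : ℕ}
    (z : (P.complex.linearYonedaObj R Y).cycles n) :
    P.cyclesToExt R Y n z =
      P.extMk (P.cocycleHom z) (n + 1) rfl (P.d_comp_cocycleHom z) :=
  rfl

lemma cyclesToExt_surjective {X : C} (P : ProjectiveResolution X) (Y : C) (n : ℕ) :
    Function.Surjective (P.cyclesToExt R Y n) := by
  intro α
  obtain ⟨f, hf, rfl⟩ := P.extMk_surjective α (n + 1) rfl
  obtain ⟨z, rfl⟩ := P.exists_cocycleHom_eq R f hf
  exact ⟨z, rfl⟩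

/-- Both conditions say that the cocycle factors through the preceding differential. In degree 0
there is none, and `prev 0 = 0` by convention, with zero differential. -/
lemma cyclesToExt_eq_zero_iff {X : C} (P : ProjectiveResolution X) (Y : C) (n : ℕ)
    (z : (P.complex.linearYonedaObj R Y).cycles n) :
    P.cyclesToExt R Y n z = 0 ↔ ((P.complex.linearYonedaObj R Y).homologyπ n).hom z = 0 := by
  rcases n with _ | n
  · rw [cyclesToExt_apply, extMk_zero_degree_eq_zero_iff,
      HomologicalComplex.homologyπ_eq_zero_iff _ 0 0 (by simp)]
    constructor
    · intro h
      refine ⟨0, ?_⟩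
      rw [map_zero]
      exact h.symm
    · rintro ⟨x, hx⟩
      rw [HomologicalComplex.shape _ _ _ (by simp)] at hx
      exact hx.symm
  · rw [cyclesToExt_apply, extMk_eq_zero_iff _ _ _ _ _ n rfl,
      HomologicalComplex.homologyπ_eq_zero_iff _ n (n + 1) (by simp)]
    rfl

/-- The homology of the complex `Hom(P, Y)` is `Ext X Y n`. -/
def homologyEquivExt {X : C} (P : ProjectiveResolution X) (Y : C) (n : ℕ) :
    (P.complex.linearYonedaObj R Y).homology n ≃ₗ[R] Abelian.Ext X Y n :=
  (LinearMap.quotKerEquivOfSurjective ((P.complex.linearYonedaObj R Y).homologyπ n).hom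
    ((ModuleCat.epi_iff_surjective _).mp inferInstance)).symm ≪≫ₗ
  Submodule.quotEquivOfEq _ _ (by ext z; exact (P.cyclesToExt_eq_zero_iff Y n z).symm) ≪≫ₗ
  LinearMap.quotKerEquivOfSurjective (P.cyclesToExt R Y n) (P.cyclesToExt_surjective Y n)

lemma homologyEquivExt_homologyπ {X : C} (P : ProjectiveResolution X) (Y : C) (n : ℕ)
    (z : (P.complex.linearYonedaObj R Y).cycles n) :
    P.homologyEquivExt Y n (((P.complex.linearYonedaObj R Y).homologyπ n).hom z) =
      P.cyclesToExt R Y n z := by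
  have : (LinearMap.quotKerEquivOfSurjective ((P.complex.linearYonedaObj R Y).homologyπ n).hom
    ((ModuleCat.epi_iff_surjective _).mp inferInstance)).symm
      (((P.complex.linearYonedaObj R Y).homologyπ n).hom z) = Submodule.Quotient.mk z := by
    rw [LinearEquiv.symm_apply_eq]
    rfl
  simp only [homologyEquivExt, LinearEquiv.trans_apply, this]
  rfl

lemma homologyEquivExt_naturality {X X' : C} {P : ProjectiveResolution X}
    {P' : ProjectiveResolution X'} {g : X' ⟶ X} (φ : Hom P' P g) (Y : C) (n : ℕ)
    (x : (P.complex.linearYonedaObj R Y).homology n) :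
    P'.homologyEquivExt Y n ((HomologicalComplex.homologyMap (linearYonedaMap R φ.hom Y) n).hom x) =
      (Abelian.Ext.mk₀ g).comp (P.homologyEquivExt Y n x) (zero_add n) := by
  obtain ⟨z, rfl⟩ := (ModuleCat.epi_iff_surjective
    ((P.complex.linearYonedaObj R Y).homologyπ n)).mp inferInstance x
  have h1 : (HomologicalComplex.homologyMap (linearYonedaMap R φ.hom Y) n).hom
      (((P.complex.linearYonedaObj R Y).homologyπ n).hom z) =
      ((P'.complex.linearYonedaObj R Y).homologyπ n).hom
        ((HomologicalComplex.cyclesMap (linearYonedaMap R φ.hom Y) n).hom z) :=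
    ConcreteCategory.congr_hom
      (HomologicalComplex.homologyπ_naturality (linearYonedaMap R φ.hom Y) n) z
  have h2 : P'.cocycleHom ((HomologicalComplex.cyclesMap (linearYonedaMap R φ.hom Y) n).hom z) =
      φ.hom.f n ≫ P.cocycleHom z :=
    ConcreteCategory.congr_hom
      (HomologicalComplex.cyclesMap_i (linearYonedaMap R φ.hom Y) n) z
  erw [h1, homologyEquivExt_homologyπ, homologyEquivExt_homologyπ]
  rw [cyclesToExt_apply, cyclesToExt_apply, mk₀_comp_extMk _ _ _ _ φ]
  congr 1

variable [EnoughProjectives C]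

variable (R) in
/-- `Ext` defined by projective resolutions agrees with `Ext` defined by the derived category. -/
def _root_.extLinearEquiv (X Y : C) (n : ℕ) :
    ((_root_.Ext R C n).obj (op X)).obj Y ≃ₗ[R] Abelian.Ext X Y n :=
  ((projectiveResolution X).isoExt n Y).toLinearEquiv ≪≫ₗ
    (projectiveResolution X).homologyEquivExt Y n

/-- This turns the transition maps of the direct systems into precomposition in `Abelian.Ext`. -/
lemma _root_.extLinearEquiv_naturality {X X' : C} (g : X' ⟶ X) (Y : C) (n : ℕ)
    (x : ((_root_.Ext R C n).obj (op X)).obj Y) :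
    extLinearEquiv R X' Y n ((((_root_.Ext R C n).map g.op).app Y).hom x) =
      (Abelian.Ext.mk₀ g).comp (extLinearEquiv R X Y n x) (zero_add n) := by
  let φ : Hom (projectiveResolution X') (projectiveResolution X) g :=
    { hom := ProjectiveResolution.lift g _ _
      hom_f_zero_comp_π_f_zero := by
        rw [lift_commutes_zero, ChainComplex.single₀_map_f_zero]
        rfl }
  have h := ConcreteCategory.congr_hom (isoExt_hom_naturality (R := R) φ Y n) x
  refine (congrArg ((projectiveResolution X').homologyEquivExt Y n) h).trans ?_
  exact homologyEquivExt_naturality φ Y n _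

end CategoryTheory.ProjectiveResolution

/-! ### Vanishing of local cohomology at a prime, elementwise. -/

namespace LocalCohomologySupport

variable {R : Type u} [CommRing R]

lemma shortExact_of_exact {L M N : Type u} [AddCommGroup L] [Module R L] [AddCommGroup M]
    [Module R M] [AddCommGroup N] [Module R N] {f : L →ₗ[R] M} {g : M →ₗ[R] N}
    (hf : Function.Injective f) (hg : Function.Surjective g) (h : Function.Exact f g) :
    (ShortComplex.mk (ModuleCat.ofHom f) (ModuleCat.ofHom g)
      (ModuleCat.hom_ext (LinearMap.ext h.apply_apply_eq_zero))).ShortExact where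
  exact := (ShortComplex.ShortExact.moduleCat_exact_iff_function_exact _).mpr h
  mono_f := (ModuleCat.mono_iff_injective _).mpr hf
  epi_g := (ModuleCat.epi_iff_surjective _).mpr hg

lemma smul_eq_mk₀_comp {X Y : ModuleCat.{u} R} {i : ℕ} (r : R) (e : Abelian.Ext X Y i) :
    r • e = (Abelian.Ext.mk₀ (r • 𝟙 X)).comp e (zero_add i) := by
  simp [Abelian.Ext.mk₀_smul]

/-- The module `R / a ^ k`. -/
abbrev quotPow (a : Ideal R) (k : ℕ) : ModuleCat.{u} R := ModuleCat.of R (R ⧸ a ^ k)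

/-- The projection `R / a ^ l ⟶ R / a ^ k` for `k ≤ l`. -/
def quotPowMap (a : Ideal R) {k l : ℕ} (h : k ≤ l) : quotPow a l ⟶ quotPow a k :=
  ModuleCat.ofHom (Submodule.mapQ (a ^ l) (a ^ k) LinearMap.id (Ideal.pow_le_pow_right h))

lemma quotPowMap_comp (a : Ideal R) {k l m : ℕ} (h : k ≤ l) (h' : l ≤ m) :
    quotPowMap a h' ≫ quotPowMap a h = quotPowMap a (h.trans h') := by
  ext
  rfl

lemma quotPowMap_surjective (a : Ideal R) {k l : ℕ} (h : k ≤ l) :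
    Function.Surjective (quotPowMap a h).hom := by
  intro x
  obtain ⟨x, rfl⟩ := Submodule.Quotient.mk_surjective _ x
  exact ⟨Submodule.Quotient.mk x, rfl⟩

/-- The class in the local cohomology of an element of `Ext^i(R / a ^ k, N)` becomes zero after
localization at `p`. -/
def ClassVanishesAt (p : PrimeSpectrum R) (a : Ideal R) {i k : ℕ} {N : ModuleCat.{u} R}
    (e : Abelian.Ext (quotPow a k) N i) : Prop :=
  ∃ l, ∃ h : k ≤ l, ∃ s ∉ p.asIdeal,
    s • (Abelian.Ext.mk₀ (quotPowMap a h)).comp e (zero_add i) = 0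

/-- The localization at `p` of the `i`-th local cohomology of `N` is zero. -/
def VanishesAt (p : PrimeSpectrum R) (a : Ideal R) (i : ℕ) (N : ModuleCat.{u} R) : Prop :=
  ∀ (k : ℕ) (e : Abelian.Ext (quotPow a k) N i), ClassVanishesAt p a e

variable {p : PrimeSpectrum R} {a : Ideal R} {i k : ℕ} {N : ModuleCat.{u} R}

lemma one_notMem (p : PrimeSpectrum R) : (1 : R) ∉ p.asIdeal :=
  (Ideal.ne_top_iff_one _).mp p.2.ne_top

lemma mul_notMem {s t : R} (hs : s ∉ p.asIdeal) (ht : t ∉ p.asIdeal) : s * t ∉ p.asIdeal :=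
  fun h ↦ (p.2.mem_or_mem h).elim hs ht

namespace ClassVanishesAt

lemma of_restrict {e : Abelian.Ext (quotPow a k) N i} {l : ℕ} (h : k ≤ l) {s : R}
    (hs : s ∉ p.asIdeal)
    (he : ClassVanishesAt p a (s • (Abelian.Ext.mk₀ (quotPowMap a h)).comp e (zero_add i))) :
    ClassVanishesAt p a e := by
  obtain ⟨m, h', t, ht, hm⟩ := he
  refine ⟨m, h.trans h', t * s, mul_notMem ht hs, ?_⟩
  rw [Abelian.Ext.comp_smul, Abelian.Ext.mk₀_comp_mk₀_assoc, quotPowMap_comp, smul_smul] at hm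
  exact hm

lemma of_smul_eq_zero {e : Abelian.Ext (quotPow a k) N i} {s : R}
    (hs : s ∉ p.asIdeal) (he : s • e = 0) : ClassVanishesAt p a e :=
  ⟨k, le_rfl, s, hs, by rw [← Abelian.Ext.comp_smul, he, Abelian.Ext.comp_zero]⟩

lemma zero : ClassVanishesAt p a (0 : Abelian.Ext (quotPow a k) N i) :=
  of_smul_eq_zero (one_notMem p) (smul_zero _)

lemma comp {e : Abelian.Ext (quotPow a k) N i} (he : ClassVanishesAt p a e)
    {N' : ModuleCat.{u} R} {j n : ℕ} (β : Abelian.Ext N N' j) (h : i + j = n) :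
    ClassVanishesAt p a (e.comp β h) := by
  obtain ⟨l, hl, s, hs, h0⟩ := he
  refine ⟨l, hl, s, hs, ?_⟩
  rw [← Abelian.Ext.comp_assoc _ _ _ (zero_add i) h (by lia), ← Abelian.Ext.smul_comp, h0,
    Abelian.Ext.zero_comp]

end ClassVanishesAt

namespace VanishesAt

lemma middle {S : ShortComplex (ModuleCat.{u} R)} (hS : S.ShortExact)
    (h₁ : VanishesAt p a i S.X₁) (h₃ : VanishesAt p a i S.X₃) : VanishesAt p a i S.X₂ := by
  intro k e
  obtain ⟨l, hl, s, hs, h0⟩ := h₃ k (e.comp (Abelian.Ext.mk₀ S.g) (add_zero i))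
  rw [← Abelian.Ext.comp_assoc _ _ _ (zero_add i) (add_zero i) (by lia),
    ← Abelian.Ext.smul_comp] at h0
  obtain ⟨x, hx⟩ := Abelian.Ext.covariant_sequence_exact₂ _ hS _ h0
  refine .of_restrict hl hs ?_
  rw [← hx]
  exact (h₁ l x).comp _ _

/-- This is exactness of H^i(X₂) → H^i(X₃) → H^{i+1}(X₁) at p: restrict until the connecting image
dies, then lift to X₂. -/
lemma right {S : ShortComplex (ModuleCat.{u} R)} (hS : S.ShortExact)
    (h₂ : VanishesAt p a i S.X₂) (h₁ : VanishesAt p a (i + 1) S.X₁) :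
    VanishesAt p a i S.X₃ := by
  intro k e
  obtain ⟨l, hl, s, hs, h0⟩ := h₁ k (e.comp hS.extClass rfl)
  rw [← Abelian.Ext.comp_assoc _ _ _ (zero_add i) rfl (by lia),
    ← Abelian.Ext.smul_comp] at h0
  obtain ⟨x, hx⟩ := Abelian.Ext.covariant_sequence_exact₃ _ hS _ rfl h0
  refine .of_restrict hl hs ?_
  rw [← hx]
  exact (h₂ l x).comp _ _

lemma of_iso {N' : ModuleCat.{u} R} (f : N ≅ N') (h : VanishesAt p a i N) :
    VanishesAt p a i N' := by
  intro k e
  have : e = (e.comp (Abelian.Ext.mk₀ f.inv) (add_zero i)).comp (Abelian.Ext.mk₀ f.hom)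
      (add_zero i) := by
    rw [Abelian.Ext.comp_assoc _ _ _ _ (add_zero 0) (by lia)]
    simp
  rw [this]
  exact (h k _).comp _ _

lemma of_smul_eq_zero {s : R} (hs : s ∉ p.asIdeal) (h : ∀ x : N, s • x = 0) :
    VanishesAt p a i N := by
  intro k e
  refine .of_smul_eq_zero hs ?_
  have : s • 𝟙 N = 0 := ModuleCat.hom_ext (LinearMap.ext h)
  rw [Abelian.Ext.smul_eq_comp_mk₀, this, Abelian.Ext.mk₀_zero, Abelian.Ext.comp_zero]

lemma pow_smul_eq_zero {y : R} (hy : y ∈ a) (e : Abelian.Ext (quotPow a k) N i) :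
    y ^ k • e = 0 := by
  have : y ^ k • 𝟙 (quotPow a k) = 0 := by
    refine ModuleCat.hom_ext (LinearMap.ext fun x ↦ ?_)
    obtain ⟨x, rfl⟩ := Submodule.Quotient.mk_surjective _ x
    change Submodule.Quotient.mk (y ^ k • x) = (0 : R ⧸ a ^ k)
    rw [Submodule.Quotient.mk_eq_zero]
    exact Ideal.mul_mem_right _ _ (Ideal.pow_mem_pow hy k)
  rw [smul_eq_mk₀_comp, this, Abelian.Ext.mk₀_zero, Abelian.Ext.zero_comp]

/-- If `y ∈ a` is regular on `N`, then the vanishing of `H^i_a(N / y N)` at `p` implies that of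
`H^{i + 1}_a(N)`. -/
lemma succ_of_regular {y : R} (hy : y ∈ a) {S : ShortComplex (ModuleCat.{u} R)}
    (hS : S.ShortExact) (e₁₂ : S.X₁ ≅ S.X₂) (hf : e₁₂.inv ≫ S.f = y • 𝟙 S.X₂)
    (h₃ : VanishesAt p a i S.X₃) : VanishesAt p a (i + 1) S.X₂ := by
  -- Induction on the power of y killing e. If y^{r+1} e = 0, then y^r e comes from Ext^i(R/a^k, X₃)
  -- by the connecting map, so it dies at p; a restricted multiple of e is then killed by y^r.
  have key : ∀ (r k : ℕ) (e : Abelian.Ext (quotPow a k) S.X₂ (i + 1)), y ^ r • e = 0 →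
      ClassVanishesAt p a e := by
    intro r
    induction r with
    | zero =>
      intro k e he
      rw [pow_zero, one_smul] at he
      rw [he]
      exact .zero
    | succ r ih =>
      intro k e he
      have h0 : ((y ^ r • e).comp (Abelian.Ext.mk₀ e₁₂.inv) (add_zero _)).comp
          (Abelian.Ext.mk₀ S.f) (add_zero _) = 0 := by
        rw [Abelian.Ext.comp_assoc _ _ _ _ (add_zero 0) (by lia), Abelian.Ext.mk₀_comp_mk₀, hf,
          ← Abelian.Ext.smul_eq_comp_mk₀, smul_smul, ← pow_succ', he]
      obtain ⟨x, hx⟩ := Abelian.Ext.covariant_sequence_exact₁ _ hS _ h0 rfl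
      have h1 : ClassVanishesAt p a (y ^ r • e) := by
        have : y ^ r • e = ((y ^ r • e).comp (Abelian.Ext.mk₀ e₁₂.inv) (add_zero _)).comp
            (Abelian.Ext.mk₀ e₁₂.hom) (add_zero _) := by
          rw [Abelian.Ext.comp_assoc _ _ _ _ (add_zero 0) (by lia)]
          simp
        rw [this, ← hx]
        exact ((h₃ k x).comp _ _).comp _ _
      obtain ⟨l, hl, s, hs, h2⟩ := h1
      refine .of_restrict hl hs (ih l _ ?_)
      rw [smul_comm, ← Abelian.Ext.comp_smul, h2]
  exact fun k e ↦ key k k e (pow_smul_eq_zero hy e)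

end VanishesAt

/-- Quotients of the terms of a short exact sequence `ker π → F → X` by a submodule of `F`, and
extension classes. -/
lemma exists_ext_of_quotient {F X X' : Type u} [AddCommGroup F] [Module R F] [AddCommGroup X]
    [Module R X] [AddCommGroup X'] [Module R X'] {π : F →ₗ[R] X} (hπ : Function.Surjective π)
    (L : Submodule R F) (q : F ⧸ L →ₗ[R] X') (τ : X →ₗ[R] X') (hq : Function.Surjective q)
    (hτ : q ∘ₗ L.mkQ = τ ∘ₗ π) (hker : ∀ x, τ (π x) = 0 → ∃ y, π y = 0 ∧ x - y ∈ L)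
    {T : ModuleCat.{u} R} {i n : ℕ}
    (hn : 1 + i = n) (e : Abelian.Ext (ModuleCat.of R (LinearMap.ker π ⧸ L.comap (LinearMap.ker π).subtype)) T i) :
    ∃ e' : Abelian.Ext (ModuleCat.of R X') T n,
      (Abelian.Ext.mk₀ (ModuleCat.ofHom τ)).comp e' (zero_add _) =
        (LinearMap.shortExact_shortComplexKer hπ).extClass.comp
          ((Abelian.Ext.mk₀ (ModuleCat.ofHom
            (L.comap (LinearMap.ker π).subtype).mkQ)).comp e (zero_add i)) hn ∧
      (Abelian.Ext.mk₀ (ModuleCat.ofHom q)).comp e' (zero_add _) = 0 := by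
  let f : (LinearMap.ker π ⧸ L.comap (LinearMap.ker π).subtype) →ₗ[R] F ⧸ L :=
    Submodule.mapQ _ _ (LinearMap.ker π).subtype le_rfl
  have hqm : ∀ x, q (Submodule.Quotient.mk x) = τ (π x) := fun x ↦ LinearMap.congr_fun hτ x
  have hf : Function.Injective f := by
    rw [← LinearMap.ker_eq_bot, LinearMap.ker_eq_bot']
    intro x hx
    obtain ⟨x, rfl⟩ := Submodule.Quotient.mk_surjective _ x
    have hx' : Submodule.Quotient.mk (p := L) (x : F) = 0 := hx
    rw [Submodule.Quotient.mk_eq_zero] at hx' ⊢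
    exact hx'
  have hex : Function.Exact f q := by
    intro x
    obtain ⟨x, rfl⟩ := Submodule.Quotient.mk_surjective _ x
    rw [hqm]
    constructor
    · intro h
      obtain ⟨y, hy, hxy⟩ := hker x h
      refine ⟨Submodule.Quotient.mk ⟨y, hy⟩, ?_⟩
      change Submodule.Quotient.mk y = _
      rw [Eq.comm, Submodule.Quotient.eq]
      exact hxy
    · rintro ⟨z, hz⟩
      obtain ⟨z, rfl⟩ := Submodule.Quotient.mk_surjective _ z
      have hz' : Submodule.Quotient.mk (p := L) (z : F) = Submodule.Quotient.mk x := hz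
      rw [← hqm, ← hz', hqm, LinearMap.mem_ker.mp z.2, map_zero]
  have h₂ := shortExact_of_exact hf hq hex
  have h₁ := LinearMap.shortExact_shortComplexKer hπ
  let φ : π.shortComplexKer ⟶ ShortComplex.mk (ModuleCat.ofHom f) (ModuleCat.ofHom q)
      (ModuleCat.hom_ext (LinearMap.ext hex.apply_apply_eq_zero)) :=
    { τ₁ := ModuleCat.ofHom (L.comap (LinearMap.ker π).subtype).mkQ
      τ₂ := ModuleCat.ofHom L.mkQ
      τ₃ := ModuleCat.ofHom τ
      comm₁₂ := by ext x; rfl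
      comm₂₃ := by ext x; exact hqm x }
  -- The witness is e composed with the connecting class of the quotient sequence. The first
  -- identity is naturality of that class; the second holds because it vanishes after pullback along
  -- q.
  refine ⟨h₂.extClass.comp e hn, ?_, h₂.comp_extClass_assoc e hn⟩
  have := h₁.extClass_naturality h₂ φ
  rw [← Abelian.Ext.comp_assoc _ _ _ (zero_add 1) hn (by lia),
    ← Abelian.Ext.comp_assoc _ _ _ (add_zero 1) (zero_add i) (by lia)]
  exact congrArg (fun z ↦ Abelian.Ext.comp z e hn) this.symm

/-- The kernel of Ext^i(X₃, N) → Ext^i(X₂, N) is the image of Ext^{i-1}(X₁, N), and is zero for i =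
0. -/
lemma exists_smul_eq_zero_of_comp_eq_zero {S : ShortComplex (ModuleCat.{u} R)}
    (hS : S.ShortExact) {N : ModuleCat.{u} R} {i : ℕ}
    (h₁ : ∀ j < i, ∀ e : Abelian.Ext S.X₁ N j, ∃ s ∉ p.asIdeal, s • e = 0)
    (e : Abelian.Ext S.X₃ N i) {s : R} (hs : s ∉ p.asIdeal)
    (he : s • (Abelian.Ext.mk₀ S.g).comp e (zero_add i) = 0) :
    ∃ s ∉ p.asIdeal, s • e = 0 := by
  rw [← Abelian.Ext.comp_smul] at he
  rcases i with _ | i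
  · refine ⟨s, hs, ?_⟩
    have := hS.epi_g
    exact Abelian.Ext.precomp_mk₀_injective_of_epi N S.g
      (he.trans (Abelian.Ext.comp_zero _ N 0 0 (zero_add 0)).symm)
  · obtain ⟨x, hx⟩ := Abelian.Ext.contravariant_sequence_exact₃ hS N _ he (add_comm 1 i)
    obtain ⟨t, ht, htx⟩ := h₁ i (Nat.lt_succ_self i) x
    refine ⟨t * s, mul_notMem ht hs, ?_⟩
    rw [mul_smul, ← hx, ← Abelian.Ext.comp_smul, htx, Abelian.Ext.comp_zero]

/-! ### Artin–Rees, and dévissage from R/a^k to all modules killed by a power of a. -/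

variable [IsNoetherianRing R]

/-- If `T` is killed by a power of `a`, every class in `Ext^i(K, T)` comes from some
`Ext^i(K / a ^ n K, T)`. -/
lemma exists_ext_quotient_pow_smul {T : ModuleCat.{u} R} {m : ℕ}
    (hT : ∀ r ∈ a ^ m, ∀ x : T, r • x = 0) (i : ℕ) (K : Type u) [AddCommGroup K] [Module R K]
    [Module.Finite R K] (e : Abelian.Ext (ModuleCat.of R K) T i) :
    ∃ (n : ℕ) (e' : Abelian.Ext (ModuleCat.of R (K ⧸ (a ^ n • ⊤ : Submodule R K))) T i),
      (Abelian.Ext.mk₀ (ModuleCat.ofHom (a ^ n • ⊤ : Submodule R K).mkQ)).comp e'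
        (zero_add i) = e := by
  induction i generalizing K with
  | zero =>
    obtain ⟨f, rfl⟩ := (Abelian.Ext.mk₀_bijective _ _).2 e
    have hf : (a ^ m • ⊤ : Submodule R K) ≤ LinearMap.ker f.hom := by
      rw [Submodule.smul_le]
      intro r hr x _
      rw [LinearMap.mem_ker, map_smul, hT r hr]
    refine ⟨m, Abelian.Ext.mk₀ (ModuleCat.ofHom (Submodule.liftQ _ f.hom hf)), ?_⟩
    rw [Abelian.Ext.mk₀_comp_mk₀]
    congr 1
  | succ i ih =>
    obtain ⟨F, _, _, _, _, π, hπ⟩ := Module.exists_finite_presentation R K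
    have h₁ := LinearMap.shortExact_shortComplexKer hπ
    obtain ⟨e₀, rfl⟩ := precomp_extClass_surjective_of_projective_X₂ T h₁ i e
    obtain ⟨n, e₁, rfl⟩ := ih (LinearMap.ker π) e₀
    -- Artin–Rees: a^{n+c} F ∩ ker π ⊆ a^n ker π, so the class found on ker π / a^n ker π pulls back
    -- to the kernel of F / a^{n+c} F → K / a^{n+c} K.
    obtain ⟨c, hc⟩ := Ideal.exists_pow_inf_eq_pow_smul a (LinearMap.ker π)
    have hle : (a ^ (n + c) • ⊤ : Submodule R F).comap (LinearMap.ker π).subtype ≤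
        (a ^ n • ⊤ : Submodule R (LinearMap.ker π)) := by
      intro x hx
      have h2 : (x : F) ∈ a ^ (n + c) • ⊤ ⊓ LinearMap.ker π := ⟨hx, x.2⟩
      rw [hc (n + c) (by lia), Nat.add_sub_cancel] at h2
      have h3 : (x : F) ∈ a ^ n • LinearMap.ker π := Submodule.smul_mono le_rfl inf_le_right h2
      have h4 : Submodule.map (LinearMap.ker π).subtype
          (a ^ n • ⊤ : Submodule R (LinearMap.ker π)) = a ^ n • LinearMap.ker π := by
        rw [Submodule.map_smul'', Submodule.map_top, Submodule.range_subtype]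
      rw [← h4] at h3
      obtain ⟨z, hz, hzx⟩ := h3
      rwa [← Subtype.ext hzx]
    have hmap : Submodule.map π (a ^ (n + c) • ⊤ : Submodule R F) = a ^ (n + c) • ⊤ := by
      rw [Submodule.map_smul'', Submodule.map_top, LinearMap.range_eq_top.mpr hπ]
    let q : (F ⧸ (a ^ (n + c) • ⊤ : Submodule R F)) →ₗ[R]
        (K ⧸ (a ^ (n + c) • ⊤ : Submodule R K)) :=
      Submodule.mapQ _ _ π (by rw [← Submodule.map_le_iff_le_comap, hmap])
    obtain ⟨e', he', -⟩ := exists_ext_of_quotient hπ (a ^ (n + c) • ⊤ : Submodule R F) q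
      (a ^ (n + c) • ⊤ : Submodule R K).mkQ
      (by
        intro x
        obtain ⟨x, rfl⟩ := Submodule.Quotient.mk_surjective _ x
        obtain ⟨x, rfl⟩ := hπ x
        exact ⟨Submodule.Quotient.mk x, rfl⟩)
      (by ext x; rfl)
      (by
        intro x hx
        rw [Submodule.mkQ_apply, Submodule.Quotient.mk_eq_zero, ← hmap] at hx
        obtain ⟨y, hy, hyx⟩ := hx
        exact ⟨x - y, by rw [map_sub, hyx, sub_self], by rwa [sub_sub_cancel]⟩)
      (add_comm 1 i)
      ((Abelian.Ext.mk₀ (ModuleCat.ofHom (Submodule.factor hle))).comp e₁ (zero_add i))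
    refine ⟨n + c, e', he'.trans ?_⟩
    rw [Abelian.Ext.mk₀_comp_mk₀_assoc]
    rfl

/-- Local cohomology of a module killed by a power of `a` vanishes in positive degrees. -/
lemma VanishesAt.succ_of_pow_smul_eq_zero {T : ModuleCat.{u} R} {m : ℕ}
    (hT : ∀ r ∈ a ^ m, ∀ x : T, r • x = 0) (i : ℕ) : VanishesAt p a (i + 1) T := by
  intro k e
  have hπ : Function.Surjective (a ^ k).mkQ := Submodule.mkQ_surjective _
  have h₁ := LinearMap.shortExact_shortComplexKer hπ
  obtain ⟨e₀, rfl⟩ := precomp_extClass_surjective_of_projective_X₂ T h₁ i e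
  obtain ⟨n, e₁, rfl⟩ := exists_ext_quotient_pow_smul hT i (LinearMap.ker (a ^ k).mkQ) e₀
  -- Here ker = a^k, so a^n · ker = a^{k+n} exactly and no Artin–Rees constant is needed.
  have hle : Submodule.comap (LinearMap.ker (a ^ k).mkQ).subtype (a ^ (k + n)) ≤
      (a ^ n • ⊤ : Submodule R (LinearMap.ker (a ^ k).mkQ)) := by
    intro x hx
    have h4 : Submodule.map (LinearMap.ker (a ^ k).mkQ).subtype
        (a ^ n • ⊤ : Submodule R (LinearMap.ker (a ^ k).mkQ)) = a ^ (k + n) := by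
      rw [Submodule.map_smul'', Submodule.map_top, Submodule.range_subtype, Submodule.ker_mkQ,
        smul_eq_mul, ← pow_add, add_comm]
    have hx' : (x : R) ∈ a ^ (k + n) := hx
    rw [← h4] at hx'
    obtain ⟨z, hz, hzx⟩ := hx'
    rwa [← Subtype.ext hzx]
  -- With τ the identity, e' is the given class itself, and `h0` says that it dies on R/a^{k+n}.
  obtain ⟨e', he', h0⟩ := exists_ext_of_quotient hπ (a ^ (k + n))
    (quotPowMap a (Nat.le_add_right k n)).hom LinearMap.id
    (quotPowMap_surjective a _) (by ext; rfl)
    (fun x hx ↦ ⟨x, hx, by simp⟩) (add_comm 1 i)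
    ((Abelian.Ext.mk₀ (ModuleCat.ofHom (Submodule.factor hle))).comp e₁ (zero_add i))
  refine ⟨k + n, Nat.le_add_right k n, 1, one_notMem p, ?_⟩
  rw [one_smul]
  refine Eq.trans ?_ h0
  rw [Abelian.Ext.mk₀_comp_mk₀_assoc] at he'
  have h5 : (Abelian.Ext.mk₀ (ModuleCat.ofHom (LinearMap.id (R := R) (M := R ⧸ a ^ k)))).comp e'
      (zero_add _) = e' := Abelian.Ext.mk₀_id_comp e'
  rw [h5] at he'
  rw [he']
  rfl

/-- A class in `Ext^i(X, N)` for finitely generated `X` comes from a finitely generated submodule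
of `N`. -/
lemma exists_ext_fg_submodule (N : Type u) [AddCommGroup N] [Module R N] (i : ℕ) (X : Type u)
    [AddCommGroup X] [Module R X] [Module.Finite R X]
    (e : Abelian.Ext (ModuleCat.of R X) (ModuleCat.of R N) i) :
    ∃ N' : Submodule R N, N'.FG ∧ ∃ e' : Abelian.Ext (ModuleCat.of R X) (ModuleCat.of R N') i,
      e'.comp (Abelian.Ext.mk₀ (ModuleCat.ofHom N'.subtype)) (add_zero i) = e := by
  induction i generalizing X with
  | zero =>
    obtain ⟨f, rfl⟩ := (Abelian.Ext.mk₀_bijective _ _).2 e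
    refine ⟨LinearMap.range f.hom, Module.Finite.iff_fg.mp inferInstance,
      Abelian.Ext.mk₀ (ModuleCat.ofHom f.hom.rangeRestrict), ?_⟩
    rw [Abelian.Ext.mk₀_comp_mk₀]
    congr 1
  | succ i ih =>
    obtain ⟨F, _, _, _, _, π, hπ⟩ := Module.exists_finite_presentation R X
    have h₁ := LinearMap.shortExact_shortComplexKer hπ
    obtain ⟨e₀, rfl⟩ := precomp_extClass_surjective_of_projective_X₂ _ h₁ i e
    obtain ⟨N', hN', e', rfl⟩ := ih (LinearMap.ker π) e₀
    exact ⟨N', hN', h₁.extClass.comp e' (add_comm 1 i),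
      Abelian.Ext.comp_assoc _ _ _ _ _ (by lia)⟩

/-- If the local cohomology of `N` vanishes at `p` in all degrees, then so does `Ext(X, N)` for
all finitely generated `X` killed by a power of `a`. -/
lemma exists_smul_ext_eq_zero {N : ModuleCat.{u} R} (hN : ∀ i, VanishesAt p a i N) (i m : ℕ)
    (X : Type u) [AddCommGroup X] [Module R X] [Module.Finite R X]
    (hX : a ^ m ≤ Module.annihilator R X) (e : Abelian.Ext (ModuleCat.of R X) N i) :
    ∃ s ∉ p.asIdeal, s • e = 0 := by
  induction i using Nat.strong_induction_on generalizing m X with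
  | _ i ih =>
    -- The kernel of Y → Z is again killed by a^l, so its Ext groups in degrees below i vanish at p
    -- by induction, and vanishing on Y descends to Z.
    have descend : ∀ (Y Z : Type u) [AddCommGroup Y] [Module R Y] [Module.Finite R Y]
        [AddCommGroup Z] [Module R Z] (l : ℕ) (_ : a ^ l ≤ Module.annihilator R Y)
        (f : Y →ₗ[R] Z) (_ : Function.Surjective f) (e : Abelian.Ext (ModuleCat.of R Z) N i)
        (s : R) (_ : s ∉ p.asIdeal)
        (_ : s • (Abelian.Ext.mk₀ (ModuleCat.ofHom f)).comp e (zero_add i) = 0),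
        ∃ s ∉ p.asIdeal, s • e = 0 := by
      intro Y Z _ _ _ _ _ l hl f hf e s hs he
      exact exists_smul_eq_zero_of_comp_eq_zero (LinearMap.shortExact_shortComplexKer hf)
        (fun j hj ↦ ih j hj l (LinearMap.ker f) (hl.trans
          (LinearMap.annihilator_le_of_injective _ (Submodule.injective_subtype _)))) e hs he
    have ann : ∀ l : ℕ, a ^ l ≤ Module.annihilator R (R ⧸ a ^ l) := fun l ↦ by
      rw [Ideal.annihilator_quotient]
    have cyclic : ∀ (k : ℕ) (e : Abelian.Ext (quotPow a k) N i), ∃ s ∉ p.asIdeal, s • e = 0 := by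
      intro k e
      obtain ⟨l, hl, s, hs, h0⟩ := hN i k e
      exact descend _ _ l (ann l) (quotPowMap a hl).hom (quotPowMap_surjective a hl) e s hs h0
    induction ‹Module.Finite R X› using
      IsNoetherianRing.induction_on_isQuotientEquivQuotientPrime R with
    | subsingleton X =>
      refine ⟨1, one_notMem p, ?_⟩
      have : 𝟙 (ModuleCat.of R X) = 0 :=
        ModuleCat.hom_ext (LinearMap.ext fun x ↦ Subsingleton.elim _ _)
      rw [one_smul, ← Abelian.Ext.mk₀_id_comp e, this, Abelian.Ext.mk₀_zero,
        Abelian.Ext.zero_comp]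
    | quotient X q f =>
      -- Primality of q upgrades a^m ⊆ q to a ⊆ q, so R/q is a quotient of R/a.
      have haq : a ^ 1 ≤ q.asIdeal := by
        rw [f.annihilator_eq, Ideal.annihilator_quotient] at hX
        rw [pow_one]
        exact q.2.le_of_pow_le hX
      let g : (R ⧸ a ^ 1) →ₗ[R] X := f.symm.toLinearMap ∘ₗ Submodule.factor haq
      obtain ⟨s, hs, h0⟩ := cyclic 1
        ((Abelian.Ext.mk₀ (ModuleCat.ofHom g)).comp e (zero_add i))
      exact descend _ _ 1 (ann 1) g (f.symm.surjective.comp (Submodule.factor_surjective haq)) e s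
        hs h0
    | exact X₁ X₂ X₃ f g hf hg hfg h₁ h₃ =>
      have hS := shortExact_of_exact hf hg hfg
      obtain ⟨s, hs, h0⟩ := h₁ (hX.trans (LinearMap.annihilator_le_of_injective f hf))
        ((Abelian.Ext.mk₀ (ModuleCat.ofHom f)).comp e (zero_add i))
      rw [← Abelian.Ext.comp_smul] at h0
      obtain ⟨x, hx⟩ := Abelian.Ext.contravariant_sequence_exact₂ hS N _ h0
      obtain ⟨t, ht, h0'⟩ := h₃ (hX.trans (LinearMap.annihilator_le_of_surjective g hg)) x
      refine ⟨t * s, mul_notMem ht hs, ?_⟩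
      rw [mul_smul, ← hx, ← Abelian.Ext.comp_smul, h0', Abelian.Ext.comp_zero]

end LocalCohomologySupport

/-! ### Grothendieck vanishing and finiteness of support. -/

namespace LocalCohomologySupport

variable {R : Type u} [CommRing R] {p : PrimeSpectrum R} {a : Ideal R} {i : ℕ}

lemma VanishesAt.of_subsingleton (L : Type u) [AddCommGroup L] [Module R L] [Subsingleton L] :
    VanishesAt p a i (ModuleCat.of R L) :=
  .of_smul_eq_zero (one_notMem p) fun _ ↦ Subsingleton.elim (α := L) _ _

lemma smul_eq_zero_of_equiv_quotient {L : Type u} [AddCommGroup L] [Module R L] {q : Ideal R}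
    (f : L ≃ₗ[R] R ⧸ q) {s : R} (hs : s ∈ q) (x : L) : s • x = 0 := by
  apply f.injective
  rw [map_smul, map_zero]
  obtain ⟨z, hz⟩ := Submodule.Quotient.mk_surjective _ (f x)
  rw [← hz, ← Submodule.Quotient.mk_smul, Submodule.Quotient.mk_eq_zero]
  exact Ideal.mul_mem_right _ _ hs

lemma VanishesAt.succ_of_equiv_quotient_prime {L : Type u} [AddCommGroup L] [Module R L]
    {q : PrimeSpectrum R} (f : L ≃ₗ[R] R ⧸ q.asIdeal) {y : R} (hy : y ∈ a) (hyq : y ∉ q.asIdeal)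
    (h : VanishesAt p a i (ModuleCat.of R (L ⧸ LinearMap.range (LinearMap.lsmul R L y)))) :
    VanishesAt p a (i + 1) (ModuleCat.of R L) := by
  have hinj : Function.Injective (LinearMap.lsmul R L y) := by
    rw [← LinearMap.ker_eq_bot, LinearMap.ker_eq_bot']
    intro x hx
    rw [LinearMap.lsmul_apply] at hx
    apply f.injective
    rw [map_zero]
    have h1 : y • f x = 0 := by rw [← map_smul, hx, map_zero]
    obtain ⟨z, hz⟩ := Submodule.Quotient.mk_surjective _ (f x)
    rw [← hz, ← Submodule.Quotient.mk_smul, Submodule.Quotient.mk_eq_zero] at h1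
    rw [← hz, Submodule.Quotient.mk_eq_zero]
    exact (q.2.mem_or_mem h1).resolve_left hyq
  exact succ_of_regular hy
    (shortExact_of_exact hinj (Submodule.mkQ_surjective _) (LinearMap.exact_map_mkQ_range _))
    (Iso.refl _) (by rw [Iso.refl_inv, Category.id_comp]; rfl) h

/-- The annihilator of L/yL contains q and y. This strictness makes d drop in the inductions below.
-/
lemma lt_of_mem_support_quotient {L : Type u} [AddCommGroup L] [Module R L]
    {q : PrimeSpectrum R} (f : L ≃ₗ[R] R ⧸ q.asIdeal) {y : R} (hyq : y ∉ q.asIdeal)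
    {q' : PrimeSpectrum R}
    (h : q' ∈ Module.support R (L ⧸ LinearMap.range (LinearMap.lsmul R L y))) : q < q' := by
  have h1 := Module.annihilator_le_of_mem_support h
  have hq : q.asIdeal ≤ q'.asIdeal := by
    refine le_trans ?_ h1
    intro s hs
    rw [Module.mem_annihilator]
    intro x
    obtain ⟨x, rfl⟩ := Submodule.Quotient.mk_surjective _ x
    rw [← Submodule.Quotient.mk_smul, smul_eq_zero_of_equiv_quotient f hs,
      Submodule.Quotient.mk_zero]
  have hy : y ∈ q'.asIdeal := by
    apply h1
    rw [Module.mem_annihilator]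
    intro x
    obtain ⟨x, rfl⟩ := Submodule.Quotient.mk_surjective _ x
    rw [← Submodule.Quotient.mk_smul, Submodule.Quotient.mk_eq_zero]
    exact ⟨x, rfl⟩
  exact lt_of_le_of_ne hq fun h ↦ hyq (h ▸ hy)

lemma mem_support_of_equiv_quotient {L : Type u} [AddCommGroup L] [Module R L]
    {q : PrimeSpectrum R} (f : L ≃ₗ[R] R ⧸ q.asIdeal) : q ∈ Module.support R L := by
  rw [f.support_eq, Module.mem_support_iff_of_finite, Ideal.annihilator_quotient]

/-- The function is the coheight q ↦ dim R/q; only strict decrease and the bound n are needed later.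
-/
lemma exists_strictAnti_of_ringKrullDim_eq {n : ℕ} (hn : ringKrullDim R = n) :
    ∃ d : PrimeSpectrum R → ℕ, StrictAnti d ∧ ∀ q, d q ≤ n := by
  have hle : ∀ q : PrimeSpectrum R, Order.coheight q ≤ n := fun q ↦ by
    have := Order.coheight_le_krullDim q
    rw [← ringKrullDim, hn] at this
    exact_mod_cast this
  have hfin : ∀ q : PrimeSpectrum R, Order.coheight q ≠ ⊤ := fun q ↦
    ne_top_of_le_ne_top (ENat.natCast_ne_top n) (hle q)
  refine ⟨fun q ↦ (Order.coheight q).toNat, fun q q' h ↦ ?_, fun q ↦ ?_⟩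
  · rw [← ENat.natCast_lt_natCast, ENat.natCast_toNat (hfin _), ENat.natCast_toNat (hfin _)]
    exact Order.coheight_strictAnti h (hfin _).lt_top
  · rw [← ENat.natCast_le_natCast, ENat.natCast_toNat (hfin _)]
    exact hle q

variable [IsNoetherianRing R]

/-- Grothendieck vanishing for finitely generated modules, with respect to a dimension
function. -/
theorem vanishesAt_of_support {d : PrimeSpectrum R → ℕ} (hd : StrictAnti d)
    (p : PrimeSpectrum R) (a : Ideal R) (i : ℕ) (L : Type u) [AddCommGroup L] [Module R L]
    [Module.Finite R L] (h : ∀ q ∈ Module.support R L, q ≤ p → d q < d p + i) :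
    VanishesAt p a i (ModuleCat.of R L) := by
  induction i generalizing L with
  | zero =>
    have hp : p ∉ Module.support R L := fun hp ↦ lt_irrefl _ (h p hp le_rfl)
    rw [Module.mem_support_iff_of_finite] at hp
    obtain ⟨s, hs, hsp⟩ := Set.not_subset.mp hp
    exact .of_smul_eq_zero hsp (Module.mem_annihilator.mp hs)
  | succ i ih =>
    induction ‹Module.Finite R L› using
      IsNoetherianRing.induction_on_isQuotientEquivQuotientPrime R with
    | subsingleton L => exact .of_subsingleton L
    | quotient L q f =>
      -- For R/q: if a ⊆ q, positive degrees vanish; if q ⊄ p, an element of q outside p kills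
      -- everything; otherwise some y ∈ a is regular on R/q, and d drops on the support of the
      -- quotient by y.
      by_cases ha : a ≤ q.asIdeal
      · exact .succ_of_pow_smul_eq_zero (m := 1)
          (fun r hr ↦ smul_eq_zero_of_equiv_quotient f (ha (by rwa [pow_one] at hr))) i
      by_cases hqp : q.asIdeal ≤ p.asIdeal
      · obtain ⟨y, hy, hyq⟩ := Set.not_subset.mp ha
        refine .succ_of_equiv_quotient_prime f hy hyq (ih _ fun q' hq' hq'p ↦ ?_)
        have h1 := hd (lt_of_mem_support_quotient f hyq hq')
        have h2 := h q (mem_support_of_equiv_quotient f) hqp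
        lia
      · obtain ⟨s, hs, hsp⟩ := Set.not_subset.mp hqp
        exact .of_smul_eq_zero hsp (smul_eq_zero_of_equiv_quotient f hs)
    | exact L₁ L₂ L₃ f g hf hg hfg h₁ h₃ =>
      exact .middle (shortExact_of_exact hf hg hfg)
        (h₁ fun q hq ↦ h q (Module.support_subset_of_injective f hf hq))
        (h₃ fun q hq ↦ h q (Module.support_subset_of_surjective g hg hq))

/-- The support of local cohomology in codegree one is finite, apart from closed points. -/
theorem finite_setOf_not_vanishesAt {d : PrimeSpectrum R → ℕ} (hd : StrictAnti d)
    (a : Ideal R) (i : ℕ) (L : Type u) [AddCommGroup L] [Module R L]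
    [Module.Finite R L] (h : ∀ q ∈ Module.support R L, d q ≤ i + 1) :
    {p : PrimeSpectrum R | 1 ≤ d p ∧ ¬ VanishesAt p a i (ModuleCat.of R L)}.Finite := by
  induction i generalizing L with
  | zero =>
    induction ‹Module.Finite R L› using
      IsNoetherianRing.induction_on_isQuotientEquivQuotientPrime R with
    | subsingleton L =>
      exact Set.finite_empty.subset fun p hp ↦ hp.2 (.of_subsingleton L)
    | quotient L q f =>
      refine (Set.finite_singleton q).subset fun p hp ↦ ?_
      by_contra hpq
      -- If q < p, then d(q) > d(p) ≥ 1, against d(q) ≤ 1. So p = q is the only possible bad prime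
      -- containing q.
      by_cases hqp : q ≤ p
      · have h1 := hd (lt_of_le_of_ne hqp (Ne.symm hpq))
        have h2 := h q (mem_support_of_equiv_quotient f)
        have h3 := hp.1
        lia
      · obtain ⟨s, hs, hsp⟩ := Set.not_subset.mp hqp
        exact hp.2 (.of_smul_eq_zero hsp (smul_eq_zero_of_equiv_quotient f hs))
    | exact L₁ L₂ L₃ f g hf hg hfg h₁ h₃ =>
      refine ((h₁ fun q hq ↦ h q (Module.support_subset_of_injective f hf hq)).union
        (h₃ fun q hq ↦ h q (Module.support_subset_of_surjective g hg hq))).subset fun p hp ↦ ?_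
      by_contra hn
      simp only [Set.mem_union, Set.mem_ofPred_eq, hp.1, true_and, not_or, not_not] at hn
      exact hp.2 (.middle (shortExact_of_exact hf hg hfg) hn.1 hn.2)
  | succ i ih =>
    induction ‹Module.Finite R L› using
      IsNoetherianRing.induction_on_isQuotientEquivQuotientPrime R with
    | subsingleton L =>
      exact Set.finite_empty.subset fun p hp ↦ hp.2 (.of_subsingleton L)
    | quotient L q f =>
      by_cases ha : a ≤ q.asIdeal
      · exact Set.finite_empty.subset fun p hp ↦ hp.2 (.succ_of_pow_smul_eq_zero (m := 1)
          (fun r hr ↦ smul_eq_zero_of_equiv_quotient f (ha (by rwa [pow_one] at hr))) i)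
      obtain ⟨y, hy, hyq⟩ := Set.not_subset.mp ha
      refine (ih (L ⧸ LinearMap.range (LinearMap.lsmul R L y)) fun q' hq' ↦ ?_).subset
        fun p hp ↦ ⟨hp.1, fun hv ↦ hp.2 (.succ_of_equiv_quotient_prime f hy hyq hv)⟩
      have h1 := hd (lt_of_mem_support_quotient f hyq hq')
      have h2 := h q (mem_support_of_equiv_quotient f)
      lia
    | exact L₁ L₂ L₃ f g hf hg hfg h₁ h₃ =>
      refine ((h₁ fun q hq ↦ h q (Module.support_subset_of_injective f hf hq)).union
        (h₃ fun q hq ↦ h q (Module.support_subset_of_surjective g hg hq))).subset fun p hp ↦ ?_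
      by_contra hn
      simp only [Set.mem_union, Set.mem_ofPred_eq, hp.1, true_and, not_or, not_not] at hn
      exact hp.2 (.middle (shortExact_of_exact hf hg hfg) hn.1 hn.2)

/-- Vanishing of local cohomology at `p` for all finitely generated modules implies vanishing
for all modules. -/
lemma VanishesAt.of_forall_finite
    (h : ∀ (L : Type u) [AddCommGroup L] [Module R L] [Module.Finite R L],
      VanishesAt p a i (ModuleCat.of R L))
    (N : Type u) [AddCommGroup N] [Module R N] : VanishesAt p a i (ModuleCat.of R N) := by
  intro k e
  obtain ⟨N', hN', e', rfl⟩ := exists_ext_fg_submodule N i (R ⧸ a ^ k) e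
  have : Module.Finite R N' := Module.Finite.iff_fg.mpr hN'
  exact (h N' k e').comp _ _

/-- If the local cohomology of finitely generated modules vanishes at `p` in degree `i + 1`, then
in degree `i` it suffices to consider the module `R`. -/
lemma VanishesAt.of_vanishesAt_self
    (h : ∀ (L : Type u) [AddCommGroup L] [Module R L] [Module.Finite R L],
      VanishesAt p a (i + 1) (ModuleCat.of R L))
    (hR : VanishesAt p a i (ModuleCat.of R R)) (L : Type u) [AddCommGroup L] [Module R L]
    [Module.Finite R L] : VanishesAt p a i (ModuleCat.of R L) := by
  induction ‹Module.Finite R L› using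
    IsNoetherianRing.induction_on_isQuotientEquivQuotientPrime R with
  | subsingleton L => exact .of_subsingleton L
  | quotient L q f =>
    -- For 0 → q → R → R/q → 0, the obstruction lies in H^{i+1}_a(q), which vanishes at p.
    exact .of_iso f.symm.toModuleIso (.right
      (LinearMap.shortExact_shortComplexKer (Submodule.mkQ_surjective q.asIdeal)) hR (h _))
  | exact L₁ L₂ L₃ f g hf hg hfg h₁ h₃ => exact .middle (shortExact_of_exact hf hg hfg) h₁ h₃

/-- If the local cohomology of `N` is concentrated in degrees `n - 1` and `n`, where `n` bounds a
dimension function, then its support is finite, apart from closed points. -/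
theorem exists_finite_forall_vanishesAt {d : PrimeSpectrum R → ℕ} (hd : StrictAnti d) {n : ℕ}
    (hdn : ∀ q, d q ≤ n) (a : Ideal R) (N : Type u) [AddCommGroup N] [Module R N]
    (hN : ∀ i, i + 1 ≠ n → i ≠ n → ∀ p, VanishesAt p a i (ModuleCat.of R N)) :
    ∃ S : Set (PrimeSpectrum R), S.Finite ∧
      ∀ p ∉ S, 1 ≤ d p → ∀ i, VanishesAt p a i (ModuleCat.of R N) := by
  rcases n with _ | n
  -- If n = 0, then d is identically 0 and no prime has d ≥ 1.
  · refine ⟨∅, Set.finite_empty, fun p _ hp ↦ ?_⟩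
    have := hdn p
    lia
  · refine ⟨_, finite_setOf_not_vanishesAt hd a n R fun q _ ↦ hdn q, fun p hp hdp i ↦ ?_⟩
    have hR : VanishesAt p a n (ModuleCat.of R R) := by
      by_contra hR
      exact hp ⟨hdp, hR⟩
    -- Since d(p) ≥ 1, d(q) ≤ n + 1 < d(p) + (n + 1) for all q.
    have htop : ∀ (L : Type u) [AddCommGroup L] [Module R L] [Module.Finite R L],
        VanishesAt p a (n + 1) (ModuleCat.of R L) := fun L _ _ _ ↦
      vanishesAt_of_support hd p a (n + 1) L fun q _ _ ↦ by
        have := hdn q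
        lia
    by_cases h1 : i + 1 = n + 1
    · obtain rfl : i = n := by lia
      exact .of_forall_finite (fun L _ _ _ ↦ .of_vanishesAt_self htop hR L) N
    by_cases h2 : i = n + 1
    · subst h2
      exact .of_forall_finite htop N
    exact hN i h1 h2 p

end LocalCohomologySupport

/-! ### Passage between the colimits and their finite stages. -/

namespace LocalCohomologySupport

variable {R : Type u} [CommRing R]

section Colimit

universe v u'

variable {J : Type} [SmallCategory J] [IsFiltered J] {C : Type u'} [Category.{v} C]
  (F : J ⥤ C ⥤ ModuleCat.{u} R) (N : C)

instance : PreservesColimitsOfShape J (forget (ModuleCat.{u} R)) :=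
  have : PreservesFilteredColimitsOfSize.{0, 0} (forget (ModuleCat.{u} R)) :=
    preservesFilteredColimitsOfSize_shrink.{0, u, 0, u} _
  inferInstance

lemma exists_colimit_ι_app_eq (x : (colimit F).obj N) :
    ∃ (j : J) (y : (F.obj j).obj N), ((colimit.ι F j).app N).hom y = x :=
  Concrete.isColimit_exists_rep _
    (isColimitOfPreserves ((evaluation C (ModuleCat.{u} R)).obj N) (colimit.isColimit F)) x

lemma exists_map_app_eq_zero (j : J) (y : (F.obj j).obj N)
    (h : ((colimit.ι F j).app N).hom y = 0) :
    ∃ (k : J) (f : j ⟶ k), ((F.map f).app N).hom y = 0 := by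
  obtain ⟨k, f, g, hk⟩ := Concrete.isColimit_exists_of_rep_eq _
    (isColimitOfPreserves ((evaluation C (ModuleCat.{u} R)).obj N) (colimit.isColimit F))
    y (0 : (F.obj j).obj N) (h.trans (map_zero ((colimit.ι F j).app N).hom).symm)
  exact ⟨k, f, hk.trans (map_zero ((F.map g).app N).hom)⟩

end Colimit

/-- A class that is zero in the filtered colimit is already zero at some stage R/a^l, so s = 1
suffices. -/
lemma vanishesAt_of_isZero_localCohomology {a : Ideal R} {i : ℕ} {N : ModuleCat.{u} R}
    (h : IsZero ((localCohomology a i).obj N)) (p : PrimeSpectrum R) : VanishesAt p a i N := by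
  intro k e
  let F := localCohomology.diagram (localCohomology.idealPowersDiagram a) i
  have : Subsingleton ((colimit F).obj N) := ModuleCat.subsingleton_of_isZero h
  let y : (F.obj (op (op k))).obj N := (extLinearEquiv R (quotPow a k) N i).symm e
  obtain ⟨l, f, hf⟩ := exists_map_app_eq_zero F N (op (op k)) y (Subsingleton.elim _ _)
  have hkl : k ≤ l.unop.unop := f.unop.unop.le
  refine ⟨l.unop.unop, hkl, 1, one_notMem p, ?_⟩
  have h1 := extLinearEquiv_naturality (R := R) (quotPowMap a hkl) N i y
  rw [one_smul]
  refine Eq.trans ?_ (h1.symm.trans ?_)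
  · rw [LinearEquiv.apply_symm_apply]
  · exact (congrArg (extLinearEquiv R _ N i) hf).trans (map_zero _)

lemma exists_smul_generalizedLocalCohomology_eq_zero [IsNoetherianRing R] {a : Ideal R}
    {N : ModuleCat.{u} R} {p : PrimeSpectrum R} (hN : ∀ i, VanishesAt p a i N)
    (M : Type u) [AddCommGroup M] [Module R M] [Module.Finite R M] (t : ℕ)
    (x : (generalizedLocalCohomology a t (ModuleCat.of R M)).obj N) :
    ∃ s ∉ p.asIdeal, s • x = 0 := by
  obtain ⟨k, y, rfl⟩ := exists_colimit_ι_app_eq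
    (GeneralizedLocalCohomology.extDiagram a t (ModuleCat.of R M)) N x
  obtain ⟨s, hs, h0⟩ := exists_smul_ext_eq_zero hN t k.unop.unop
    (M ⧸ (a ^ k.unop.unop • ⊤ : Submodule R M))
    (by
      intro r hr
      rw [Module.mem_annihilator]
      intro z
      obtain ⟨z, rfl⟩ := Submodule.Quotient.mk_surjective _ z
      rw [← Submodule.Quotient.mk_smul, Submodule.Quotient.mk_eq_zero]
      exact Submodule.smul_mem_smul hr trivial)
    (extLinearEquiv R _ N t y)
  refine ⟨s, hs, ?_⟩
  have h1 : s • y = 0 := (extLinearEquiv R _ N t).injective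
    ((map_smul (extLinearEquiv R _ N t) s y).trans (h0.trans (map_zero _).symm))
  exact (map_smul _ s y).symm.trans ((congrArg _ h1).trans (map_zero _))

end LocalCohomologySupport

end

theorem corollary2p6 {R : Type u} [CommRing R] [IsNoetherianRing R] [IsLocalRing R]
    (n : ℕ) (hn : ringKrullDim R = n) (a : Ideal R)
    (M N : Type u) [AddCommGroup M] [Module R M] [Module.Finite R M]
    [AddCommGroup N] [Module R N]
    (hN : ∀ i : ℕ, i + 1 ≠ n → i ≠ n →
      IsZero ((localCohomology a i).obj (ModuleCat.of R N)))
    (t : ℕ) :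
    (associatedPrimes R
      ((generalizedLocalCohomology a t (ModuleCat.of R M)).obj (ModuleCat.of R N))).Finite := by
  obtain ⟨d, hd, hdn⟩ := LocalCohomologySupport.exists_strictAnti_of_ringKrullDim_eq hn
  obtain ⟨S, hS, h⟩ := LocalCohomologySupport.exists_finite_forall_vanishesAt hd hdn a N
    fun i h1 h2 ↦ LocalCohomologySupport.vanishesAt_of_isZero_localCohomology (hN i h1 h2)
  refine ((hS.image PrimeSpectrum.asIdeal).union
    (Set.finite_singleton (IsLocalRing.maximalIdeal R))).subset fun p hp ↦ ?_
  obtain ⟨hp, x, hx⟩ := isAssociatedPrime_iff.mp hp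
  by_contra hpS
  rw [Set.mem_union, not_or] at hpS
  let P : PrimeSpectrum R := ⟨p, hp⟩
  -- Nonmaximality gives d(P) > d(𝔪) ≥ 0. The resulting s ∉ p kills x, whose annihilator is p.
  have hlt : P < IsLocalRing.closedPoint R :=
    lt_of_le_of_ne (IsLocalRing.le_maximalIdeal hp.ne_top)
      fun h ↦ hpS.2 (congrArg PrimeSpectrum.asIdeal h)
  obtain ⟨s, hs, hsx⟩ := LocalCohomologySupport.exists_smul_generalizedLocalCohomology_eq_zero
    (h P (fun hP ↦ hpS.1 ⟨P, hP, rfl⟩) (Nat.one_le_of_lt (hd hlt))) M t x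
  refine hs ?_
  change s ∈ p
  rw [hx, Submodule.mem_colon_singleton]
  exact hsx
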